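/- Let $K$ be a field and let $(X,\le)$ be a locally finite partially ordered set, i.e. the set $\{z\in X\mid x\le z\le y\}$ is finite for all $x\le y$ in $X$. Let $C=KX$ be the incidence coalgebra of $X$: the $K$-vector space with basis $\{e_{x,y}\mid x,y\in X,\ x\le y\}$, with comultiplication $\Delta(e_{x,y})=\sum_{x\le z\le y}e_{x,z}\otimes e_{z,y}$ and counit $\varepsilon(e_{x,y})=\delta_{x,y}$. Let $C^*$ be its dual algebra (with the convolution product), which is identified with the incidence algebra of $X$, and let $FIA(X)\subseteq C^*$ be the subspace spanned by the elements $E_{x,y}$, $x\le y$, where $E_{x,y}(e_{u,v})=\delta_{x,u}\delta_{y,v}$; equivalently, $FIA(X)$ consists of the functions with finite support on $\{(x,y)\mid x\le y\}$. Let $C^{*rat}_l$ be the rational part of the left $C^*$-module $C^*$, i.e. the set of all $f\in C^*$ for which there exist finite families $(c_i)_i$ in $C$ and $(f_i)_i$ in $C^*$ such that $c^*f=\sum_i c^*(c_i)f_i$ for every $c^*\in C^*$; let $C^{*rat}_r$ be the rational part of the right $C^*$-module $C^*$, defined in the same way with $fc^*$ in place of $c^*f$. A coalgebra is called right (respectively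 left) semiperfect if the category of its right (respectively left) comodules has enough projectives. Then the following assertions are equivalent. (i) $FIA(X)=C^{*rat}_l$. (ii) $FIA(X)=C^{*rat}_r$. (iii) For every $x\in X$ there are finitely many elements $u\in X$ such that $u\le x$, and finitely many elements $y\in X$ such that $x\le y$. (iv) $KX$ is a left and right semiperfect coalgebra. -/

import Mathlib

universe u v w

open CategoryTheory
open scoped TensorProduct

/-! ### Comodules and semiperfect coalgebras -/

section Comodules

variable (K : Type u) [Field K] (C : Type v) [AddCommGroup C] [Module K C] [Coalgebra K C]

/-- A right comodule over the `K`-coalgebra `C`: a `K`-vector space `M` with a coassociative and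
counital coaction `ρ : M → M ⊗ C`. -/
structure RightComodule where
  carrier : Type w
  [addCommGroup : AddCommGroup carrier]
  [module : Module K carrier]
  coact : carrier →ₗ[K] carrier ⊗[K] C
  coassoc : (TensorProduct.assoc K carrier C C).toLinearMap ∘ₗ coact.rTensor C ∘ₗ coact =
    (Coalgebra.comul (R := K) (A := C)).lTensor carrier ∘ₗ coact
  counit_coact : (Coalgebra.counit (R := K) (A := C)).lTensor carrier ∘ₗ coact =
    (TensorProduct.mk K carrier K).flip 1

/-- A left comodule over the `K`-coalgebra `C`: a `K`-vector space `M` with a coassociative and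
counital coaction `M → C ⊗ M`. -/
structure LeftComodule where
  carrier : Type w
  [addCommGroup : AddCommGroup carrier]
  [module : Module K carrier]
  coact : carrier →ₗ[K] C ⊗[K] carrier
  coassoc : (TensorProduct.assoc K C C carrier).toLinearMap ∘ₗ
      (Coalgebra.comul (R := K) (A := C)).rTensor carrier ∘ₗ coact =
    coact.lTensor C ∘ₗ coact
  counit_coact : (Coalgebra.counit (R := K) (A := C)).rTensor carrier ∘ₗ coact =
    TensorProduct.mk K K carrier 1

attribute [instance] RightComodule.addCommGroup RightComodule.module
attribute [instance] LeftComodule.addCommGroup LeftComodule.module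

variable {K C}

/-- Morphisms of right comodules: the `K`-linear maps that commute with the coactions. -/
@[ext]
structure RightComodule.Hom (M N : RightComodule.{u, v, w} K C) where
  toLinearMap : M.carrier →ₗ[K] N.carrier
  comm : N.coact ∘ₗ toLinearMap = toLinearMap.rTensor C ∘ₗ M.coact

/-- Morphisms of left comodules: the `K`-linear maps that commute with the coactions. -/
@[ext]
structure LeftComodule.Hom (M N : LeftComodule.{u, v, w} K C) where
  toLinearMap : M.carrier →ₗ[K] N.carrier
  comm : N.coact ∘ₗ toLinearMap = toLinearMap.lTensor C ∘ₗ M.coact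

/-- The category of right `C`-comodules. -/
instance RightComodule.category : Category.{w} (RightComodule.{u, v, w} K C) where
  Hom M N := RightComodule.Hom M N
  id M := ⟨LinearMap.id, by simp⟩
  comp f g := ⟨g.toLinearMap ∘ₗ f.toLinearMap, by
    rw [← LinearMap.comp_assoc, g.comm, LinearMap.comp_assoc, f.comm, LinearMap.rTensor_comp,
      LinearMap.comp_assoc]⟩

/-- The category of left `C`-comodules. -/
instance LeftComodule.category : Category.{w} (LeftComodule.{u, v, w} K C) where
  Hom M N := LeftComodule.Hom M N
  id M := ⟨LinearMap.id, by simp⟩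
  comp f g := ⟨g.toLinearMap ∘ₗ f.toLinearMap, by
    rw [← LinearMap.comp_assoc, g.comm, LinearMap.comp_assoc, f.comm, LinearMap.lTensor_comp,
      LinearMap.comp_assoc]⟩

variable (K C)

/-- `C` is right semiperfect if the category of right `C`-comodules has enough projectives. -/
def IsRightSemiperfect : Prop :=
  EnoughProjectives (RightComodule.{u, v, max u v} K C)

/-- `C` is left semiperfect if the category of left `C`-comodules has enough projectives. -/
def IsLeftSemiperfect : Prop :=
  EnoughProjectives (LeftComodule.{u, v, max u v} K C)

/-! ### The dual algebra and its rational parts -/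

/-- The dual algebra `C^*` of `C`: the linear forms on `C`, with the convolution product
`(f * g)(c) = ∑ f(c₁) g(c₂)`. -/
abbrev DualAlgebra : Type (max u v) := WithConv (C →ₗ[K] K)

/-- The rational part of the left `C^*`-module `C^*`: all `f` such that, for some finite families
`(cᵢ)` in `C` and `(fᵢ)` in `C^*`, one has `g * f = ∑ g(cᵢ) fᵢ` for every `g` in `C^*`. -/
def leftRationalPart : Submodule K (DualAlgebra K C) where
  carrier := {f | ∃ (n : ℕ) (c : Fin n → C) (h : Fin n → DualAlgebra K C),
    ∀ g : DualAlgebra K C, g * f = ∑ i, g (c i) • h i}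
  zero_mem' := ⟨0, Fin.elim0, Fin.elim0, fun g => by simp⟩
  add_mem' := by
    rintro f f' ⟨n, c, h, hf⟩ ⟨n', c', h', hf'⟩
    refine ⟨n + n', Fin.append c c', Fin.append h h', fun g => ?_⟩
    rw [mul_add, hf, hf', Fin.sum_univ_add]
    simp
  smul_mem' := by
    rintro a f ⟨n, c, h, hf⟩
    refine ⟨n, c, fun i => a • h i, fun g => ?_⟩
    rw [mul_smul_comm, hf, Finset.smul_sum]
    exact Finset.sum_congr rfl fun i _ => smul_comm _ _ _

/-- The rational part of the right `C^*`-module `C^*`: all `f` such that, for some finite families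
`(cᵢ)` in `C` and `(fᵢ)` in `C^*`, one has `f * g = ∑ g(cᵢ) fᵢ` for every `g` in `C^*`. -/
def rightRationalPart : Submodule K (DualAlgebra K C) where
  carrier := {f | ∃ (n : ℕ) (c : Fin n → C) (h : Fin n → DualAlgebra K C),
    ∀ g : DualAlgebra K C, f * g = ∑ i, g (c i) • h i}
  zero_mem' := ⟨0, Fin.elim0, Fin.elim0, fun g => by simp⟩
  add_mem' := by
    rintro f f' ⟨n, c, h, hf⟩ ⟨n', c', h', hf'⟩
    refine ⟨n + n', Fin.append c c', Fin.append h h', fun g => ?_⟩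
    rw [add_mul, hf, hf', Fin.sum_univ_add]
    simp
  smul_mem' := by
    rintro a f ⟨n, c, h, hf⟩
    refine ⟨n, c, fun i => a • h i, fun g => ?_⟩
    rw [smul_mul_assoc, hf, Finset.smul_sum]
    exact Finset.sum_congr rfl fun i _ => smul_comm _ _ _

end Comodules

/-! ### The incidence coalgebra -/

section Incidence

variable (K : Type u) [Field K] (X : Type v) [PartialOrder X]

/-- The underlying space of the incidence coalgebra `KX`: the `K`-vector space with basis the
pairs `(x, y)` with `x ≤ y`. (A type synonym, as Mathlib puts another coalgebra structure on
finitely supported functions.) -/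
def IncidenceCoalgebra : Type (max u v) := {p : X × X // p.1 ≤ p.2} →₀ K

namespace IncidenceCoalgebra

noncomputable instance : AddCommGroup (IncidenceCoalgebra K X) :=
  inferInstanceAs (AddCommGroup ({p : X × X // p.1 ≤ p.2} →₀ K))

noncomputable instance : Module K (IncidenceCoalgebra K X) :=
  inferInstanceAs (Module K ({p : X × X // p.1 ≤ p.2} →₀ K))

/-- The standard basis of `KX`. -/
noncomputable def basis : Module.Basis {p : X × X // p.1 ≤ p.2} K (IncidenceCoalgebra K X) :=
  Module.Basis.ofRepr (LinearEquiv.refl K ({p : X × X // p.1 ≤ p.2} →₀ K))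

variable {X}

open scoped Classical in
/-- The basis element `e_{x,y}` of `KX` if `x ≤ y` (and `0` if not). -/
noncomputable def e (x y : X) : IncidenceCoalgebra K X :=
  if h : x ≤ y then basis K X ⟨(x, y), h⟩ else 0

lemma basis_eq_e (p : {p : X × X // p.1 ≤ p.2}) : basis K X p = e K p.1.1 p.1.2 := by
  rw [e, dif_pos p.2]

variable (X)
variable [LocallyFiniteOrder X]

open scoped Classical in
/-- `Δ(e_{x,y}) = ∑_{x ≤ z ≤ y} e_{x,z} ⊗ e_{z,y}` and `ε(e_{x,y}) = δ_{x,y}`. -/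
noncomputable instance : CoalgebraStruct K (IncidenceCoalgebra K X) where
  comul := (basis K X).constr K fun p =>
    ∑ z ∈ Finset.Icc p.1.1 p.1.2, e K p.1.1 z ⊗ₜ[K] e K z p.1.2
  counit := (basis K X).constr K fun p => if p.1.1 = p.1.2 then 1 else 0

variable {X}

lemma comul_e {x y : X} (h : x ≤ y) :
    Coalgebra.comul (R := K) (e K x y) = ∑ z ∈ Finset.Icc x y, e K x z ⊗ₜ[K] e K z y := by
  have := (basis K X).constr_basis K (fun p : {p : X × X // p.1 ≤ p.2} =>
    ∑ z ∈ Finset.Icc p.1.1 p.1.2, e K p.1.1 z ⊗ₜ[K] e K z p.1.2) ⟨(x, y), h⟩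
  rw [basis_eq_e] at this
  exact this

open scoped Classical in
lemma counit_e {x y : X} (h : x ≤ y) :
    Coalgebra.counit (R := K) (e K x y) = if x = y then 1 else 0 := by
  have := (basis K X).constr_basis K (fun p : {p : X × X // p.1 ≤ p.2} =>
    if p.1.1 = p.1.2 then (1 : K) else 0) ⟨(x, y), h⟩
  rw [basis_eq_e] at this
  exact this

variable (X)

noncomputable instance : Coalgebra K (IncidenceCoalgebra K X) where
  coassoc := by
    refine (basis K X).ext fun ⟨⟨x, y⟩, h⟩ => ?_
    rw [basis_eq_e]
    simp only at h ⊢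
    simp only [LinearMap.comp_apply, comul_e K h, map_sum, LinearMap.rTensor_tmul,
      LinearMap.lTensor_tmul, LinearEquiv.coe_coe]
    have h1 : ∀ z ∈ Finset.Icc x y, (TensorProduct.assoc K _ _ _)
        (Coalgebra.comul (R := K) (e K x z) ⊗ₜ[K] e K z y) =
        ∑ t ∈ Finset.Icc x z, e K x t ⊗ₜ[K] (e K t z ⊗ₜ[K] e K z y) := by
      intro z hz
      rw [comul_e K (Finset.mem_Icc.1 hz).1, TensorProduct.sum_tmul, map_sum]
      simp
    have h2 : ∀ t ∈ Finset.Icc x y, e K x t ⊗ₜ[K] Coalgebra.comul (R := K) (e K t y) =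
        ∑ z ∈ Finset.Icc t y, e K x t ⊗ₜ[K] (e K t z ⊗ₜ[K] e K z y) := by
      intro t ht
      rw [comul_e K (Finset.mem_Icc.1 ht).2, TensorProduct.tmul_sum]
    rw [Finset.sum_congr rfl h1, Finset.sum_congr rfl h2]
    refine Finset.sum_comm' fun z t => ?_
    simp only [Finset.mem_Icc]
    constructor
    · rintro ⟨⟨_, h4⟩, h5, h6⟩
      exact ⟨⟨h6, h4⟩, h5, h6.trans h4⟩
    · rintro ⟨⟨h3, h4⟩, h5, _⟩
      exact ⟨⟨h5.trans h3, h4⟩, h5, h3⟩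
  rTensor_counit_comp_comul := by
    refine (basis K X).ext fun ⟨⟨x, y⟩, h⟩ => ?_
    rw [basis_eq_e]
    simp only at h ⊢
    simp only [LinearMap.comp_apply, comul_e K h, map_sum, LinearMap.rTensor_tmul]
    rw [Finset.sum_eq_single x]
    · rw [counit_e K le_rfl, if_pos rfl]; rfl
    · intro z hz hzx
      rw [counit_e K (Finset.mem_Icc.1 hz).1, if_neg hzx.symm, TensorProduct.zero_tmul]
    · exact fun hx => absurd (Finset.mem_Icc.2 ⟨le_rfl, h⟩) hx
  lTensor_counit_comp_comul := by
    refine (basis K X).ext fun ⟨⟨x, y⟩, h⟩ => ?_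
    rw [basis_eq_e]
    simp only at h ⊢
    simp only [LinearMap.comp_apply, comul_e K h, map_sum, LinearMap.lTensor_tmul]
    rw [Finset.sum_eq_single y]
    · rw [counit_e K le_rfl, if_pos rfl]; rfl
    · intro z hz hzy
      rw [counit_e K (Finset.mem_Icc.1 hz).2, if_neg hzy, TensorProduct.tmul_zero]
    · exact fun hy => absurd (Finset.mem_Icc.2 ⟨h, le_rfl⟩) hy

end IncidenceCoalgebra

/-- The element `E_{x,y}` of the incidence algebra `IA(X) = (KX)^*`, for a pair `p = (x, y)` with
`x ≤ y`: the linear form on `KX` with `E_{x,y}(e_{u,v}) = δ_{x,u} δ_{y,v}`. -/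
noncomputable def incidenceDualElement (p : {p : X × X // p.1 ≤ p.2}) :
    DualAlgebra K (IncidenceCoalgebra K X) :=
  WithConv.toConv ((IncidenceCoalgebra.basis K X).coord p)

/-- `FIA(X)`, the subspace of `IA(X) = (KX)^*` spanned by all the `E_{x,y}` with `x ≤ y`, that is,
the functions of finite support on the set of pairs `x ≤ y`. -/
noncomputable def FIA : Submodule K (DualAlgebra K (IncidenceCoalgebra K X)) :=
  Submodule.span K (Set.range (incidenceDualElement K X))

end Incidence

/-! ### The incidence algebra and its rational parts -/

/-! Everything is reduced to the two finiteness conditions "down-sets `Iic x` are finite" and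
"up-sets `Ici x` are finite".

Rational parts. View linear forms on `KX` as matrices and let `χ = rowIndicator K x s` be supported
in row `x`, so that `E_{x,y}` is the case `s = {y}`. Since `E_{a,x} * E_{x,x} = E_{a,x}`,
rationality of `E_{x,x}` makes `Iic x` finite. Conversely, if `Iic x` is finite, then every `χ` in
row `x` is left rational, even the full row of ones, which lies in `FIA` only if `Ici x` is finite.
Finally `E_{x,x} * f` is row `x` of `f`, so a left rational `f` has finitely many nonzero rows. This
is `FIA_eq_leftRationalPart_iff`.

Semiperfectness. Through its coaction a right comodule carries operators `act p` that multiply like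
matrix units (`act_act`), and each vector is killed by almost all of them. If `Iic b` is finite, it
is the basis of a projective comodule generated in degree `b`, and these generate all comodules.
Conversely, let a projective `P` cover the simple comodule at `b`, and let `m` in `P` lift its
generator. Mapping `P` to the comodule of each interval `[a, b]` shows `E_{a,b} m ≠ 0`, so there are
finitely many `a ≤ b`. This is `RightComodule.isRightSemiperfect_iff`.

Left and right. Reversing the order of `X` is a coalgebra anti-isomorphism. It exchanges the two
rational parts, left and right comodules, and down-sets and up-sets, so each remaining statement
follows from its mirror image. -/

/-- A linear equivalence of coalgebras that reverses the comultiplication. -/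
structure IsCoalgebraAntiIso {K : Type u} [Field K] {C : Type v} {D : Type w} [AddCommGroup C]
    [Module K C] [Coalgebra K C] [AddCommGroup D] [Module K D] [Coalgebra K D] (φ : C ≃ₗ[K] D) :
    Prop where
  comul : Coalgebra.comul (R := K) ∘ₗ φ.toLinearMap = (TensorProduct.comm K D D).toLinearMap ∘ₗ
      TensorProduct.map φ.toLinearMap φ.toLinearMap ∘ₗ Coalgebra.comul
  counit : Coalgebra.counit (R := K) ∘ₗ φ.toLinearMap = Coalgebra.counit (R := K) (A := C)

/-! ### Coordinates on the incidence coalgebra, and reversal of the order -/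

namespace IncidenceCoalgebra

variable (K : Type u) [Field K] {X : Type v} [PartialOrder X]

lemma e_eq_zero {x y : X} (h : ¬ x ≤ y) : e K x y = 0 := dif_neg h

lemma basis_mk {x y : X} (h : x ≤ y) : basis K X ⟨(x, y), h⟩ = e K x y := basis_eq_e K _

open scoped Classical in
lemma coord_e (p : {p : X × X // p.1 ≤ p.2}) {x y : X} (h : x ≤ y) :
    (basis K X).coord p (e K x y) = if p.1.1 = x ∧ p.1.2 = y then 1 else 0 := by
  rw [← basis_mk K h, Module.Basis.coord_apply, Module.Basis.repr_self, Finsupp.single_apply]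
  refine if_congr ?_ rfl rfl
  rw [Subtype.ext_iff, Prod.ext_iff]
  exact and_congr eq_comm eq_comm

variable {K} in
lemma linearMap_ext {M : Type*} [AddCommMonoid M] [Module K M]
    {f g : IncidenceCoalgebra K X →ₗ[K] M}
    (h : ∀ x y : X, x ≤ y → f (e K x y) = g (e K x y)) : f = g :=
  (basis K X).ext fun p => by rw [basis_eq_e]; exact h _ _ p.2

variable [LocallyFiniteOrder X]

lemma comul_e' (x y : X) :
    Coalgebra.comul (R := K) (e K x y) = ∑ z ∈ Finset.Icc x y, e K x z ⊗ₜ[K] e K z y := by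
  by_cases h : x ≤ y
  · exact comul_e K h
  · rw [e_eq_zero K h, map_zero, Finset.Icc_eq_empty h, Finset.sum_empty]

variable {K}

lemma mul_apply_e (f g : DualAlgebra K (IncidenceCoalgebra K X)) (x y : X) :
    (f * g) (e K x y) = ∑ z ∈ Finset.Icc x y, f (e K x z) * g (e K z y) := by
  rw [LinearMap.convMul_apply, comul_e', map_sum, map_sum]
  rfl

omit [LocallyFiniteOrder X] in
lemma dual_ext {f g : DualAlgebra K (IncidenceCoalgebra K X)}
    (h : ∀ x y : X, x ≤ y → f (e K x y) = g (e K x y)) : f = g :=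
  WithConv.ext (linearMap_ext h)

variable (K X)

/-- The coalgebra anti-isomorphism between the incidence coalgebras of a poset and of its dual,
as a linear equivalence. -/
noncomputable def dualEquiv : IncidenceCoalgebra K X ≃ₗ[K] IncidenceCoalgebra K Xᵒᵈ :=
  (basis K X).equiv (basis K Xᵒᵈ)
    { toFun := fun p => ⟨(OrderDual.toDual p.1.2, OrderDual.toDual p.1.1), p.2⟩
      invFun := fun p => ⟨(OrderDual.ofDual p.1.2, OrderDual.ofDual p.1.1), p.2⟩
      left_inv := fun _ => rfl
      right_inv := fun _ => rfl }

variable {X}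

omit [LocallyFiniteOrder X] in
lemma dualEquiv_e (x y : X) :
    dualEquiv K X (e K x y) = e K (OrderDual.toDual y) (OrderDual.toDual x) := by
  by_cases h : x ≤ y
  · rw [← basis_mk K h, dualEquiv, Module.Basis.equiv_apply]
    exact basis_eq_e K (X := Xᵒᵈ) _
  · rw [e_eq_zero K h, map_zero, e_eq_zero]
    exact h

variable (X)

lemma comul_dualEquiv :
    Coalgebra.comul (R := K) ∘ₗ (dualEquiv K X).toLinearMap =
      (TensorProduct.comm K _ _).toLinearMap ∘ₗ
        TensorProduct.map (dualEquiv K X).toLinearMap (dualEquiv K X).toLinearMap ∘ₗ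
        Coalgebra.comul := by
  refine linearMap_ext fun x y _ => ?_
  simp only [LinearMap.comp_apply, LinearEquiv.coe_coe, dualEquiv_e, comul_e', map_sum,
    TensorProduct.map_tmul, TensorProduct.comm_tmul]
  refine Finset.sum_nbij' OrderDual.ofDual OrderDual.toDual ?_ ?_ ?_ ?_ ?_
  · intro z hz
    rw [Finset.mem_Icc] at hz ⊢
    exact ⟨hz.2, hz.1⟩
  · intro z hz
    rw [Finset.mem_Icc] at hz ⊢
    exact ⟨hz.2, hz.1⟩
  all_goals intros; rfl

lemma counit_dualEquiv :
    Coalgebra.counit (R := K) ∘ₗ (dualEquiv K X).toLinearMap =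
      Coalgebra.counit (R := K) (A := IncidenceCoalgebra K X) := by
  classical
  refine linearMap_ext fun x y h => ?_
  rw [LinearMap.comp_apply, LinearEquiv.coe_coe, dualEquiv_e, counit_e K h]
  refine (counit_e K (x := OrderDual.toDual y) (y := OrderDual.toDual x) h).trans ?_
  exact if_congr eq_comm rfl rfl

lemma isCoalgebraAntiIso_dualEquiv : IsCoalgebraAntiIso (dualEquiv K X) :=
  ⟨comul_dualEquiv K X, counit_dualEquiv K X⟩

end IncidenceCoalgebra

/-! ### Rational parts compared with the functions of finite support -/

section RationalPart

open IncidenceCoalgebra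

variable {K : Type u} [Field K] {X : Type v} [PartialOrder X]

section Duality

variable {C : Type v} {D : Type w} [AddCommGroup C] [Module K C] [Coalgebra K C]
  [AddCommGroup D] [Module K D] [Coalgebra K D]

/-- Pulling forms back along `φ` reverses convolution products (`key`), and every form on `C` is
such a pullback (`back`); so the identities `g * f = ∑ g(cᵢ) fᵢ` and `f * g = ∑ g(cᵢ) fᵢ` are
exchanged. -/
lemma mem_leftRationalPart_iff_of_antiIso (φ : C ≃ₗ[K] D)
    (hφ : IsCoalgebraAntiIso φ) (f : DualAlgebra K D) :
    WithConv.toConv (f.ofConv ∘ₗ φ.toLinearMap) ∈ leftRationalPart K C ↔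
      f ∈ rightRationalPart K D := by
  have key : ∀ a b : DualAlgebra K D, ∀ c : C,
      (WithConv.toConv (b.ofConv ∘ₗ φ.toLinearMap) *
        WithConv.toConv (a.ofConv ∘ₗ φ.toLinearMap)) c = (a * b) (φ c) := by
    intro a b c
    have h1 := LinearMap.congr_fun hφ.comul c
    simp only [LinearMap.comp_apply, LinearEquiv.coe_coe] at h1
    rw [LinearMap.convMul_apply, LinearMap.convMul_apply, h1]
    generalize (Coalgebra.comul c : C ⊗[K] C) = t
    induction t with
    | zero => simp
    | add s t hs ht => simp only [map_add, hs, ht]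
    | tmul s t => simp [mul_comm]
  have back : ∀ g : DualAlgebra K C,
      WithConv.toConv ((g.ofConv ∘ₗ φ.symm.toLinearMap) ∘ₗ φ.toLinearMap) = g := by
    intro g
    ext c
    simp
  constructor
  · rintro ⟨n, c, h, hf⟩
    refine ⟨n, fun i => φ (c i), fun i => WithConv.toConv ((h i).ofConv ∘ₗ φ.symm.toLinearMap),
      fun g => ?_⟩
    ext d
    obtain ⟨c', rfl⟩ := φ.surjective d
    rw [← key, hf]
    simp [WithConv.ofConv_sum]
  · rintro ⟨n, c, h, hf⟩
    refine ⟨n, fun i => φ.symm (c i), fun i => WithConv.toConv ((h i).ofConv ∘ₗ φ.toLinearMap),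
      fun g => ?_⟩
    ext d
    conv_lhs => rw [← back g]
    erw [key f (WithConv.toConv (g.ofConv ∘ₗ φ.symm.toLinearMap))]
    rw [hf]
    simp [WithConv.ofConv_sum]

end Duality

lemma mem_FIA_iff (f : DualAlgebra K (IncidenceCoalgebra K X)) :
    f ∈ FIA K X ↔ {p | f (basis K X p) ≠ 0}.Finite := by
  classical
  constructor
  · intro hf
    refine Submodule.span_induction ?_ ?_ ?_ ?_ hf
    · rintro _ ⟨p, rfl⟩
      refine (Set.finite_singleton p).subset fun q hq => ?_
      by_contra hqp
      refine hq ?_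
      change (basis K X).coord p (basis K X q) = 0
      rw [Module.Basis.coord_apply, Module.Basis.repr_self, Finsupp.single_eq_of_ne' hqp]
    · simp
    · intro a b _ _ ha hb
      refine (ha.union hb).subset fun p hp => ?_
      by_contra h
      simp only [Set.mem_union, Set.mem_ofPred_eq, not_or, not_not] at h
      exact hp (by simp [h.1, h.2])
    · intro a b _ hb
      refine hb.subset fun p hp h => hp ?_
      simp [h]
  · intro hf
    have : f = ∑ p ∈ hf.toFinset, f (basis K X p) • incidenceDualElement K X p := by
      refine WithConv.ext ((basis K X).ext fun q => ?_)
      rw [WithConv.ofConv_sum, LinearMap.sum_apply]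
      simp only [incidenceDualElement, WithConv.ofConv_smul, LinearMap.smul_apply,
        Module.Basis.coord_apply, Module.Basis.repr_self, Finsupp.single_apply, smul_eq_mul,
        mul_ite, mul_one, mul_zero]
      rw [Finset.sum_ite_eq]
      split_ifs with h
      · rfl
      · rw [Set.Finite.mem_toFinset] at h
        exact not_not.1 h
    rw [this]
    exact Submodule.sum_mem _ fun p _ =>
      Submodule.smul_mem _ _ (Submodule.subset_span ⟨p, rfl⟩)

lemma mem_FIA_dual_iff (f : DualAlgebra K (IncidenceCoalgebra K Xᵒᵈ)) :
    WithConv.toConv (f.ofConv ∘ₗ (dualEquiv K X).toLinearMap) ∈ FIA K X ↔ f ∈ FIA K Xᵒᵈ := by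
  rw [mem_FIA_iff, mem_FIA_iff]
  let σ : {p : X × X // p.1 ≤ p.2} ≃ {p : Xᵒᵈ × Xᵒᵈ // p.1 ≤ p.2} :=
    { toFun := fun p => ⟨(OrderDual.toDual p.1.2, OrderDual.toDual p.1.1), p.2⟩
      invFun := fun p => ⟨(OrderDual.ofDual p.1.2, OrderDual.ofDual p.1.1), p.2⟩
      left_inv := fun _ => rfl
      right_inv := fun _ => rfl }
  have h : {p | (WithConv.toConv (f.ofConv ∘ₗ (dualEquiv K X).toLinearMap)) (basis K X p) ≠ 0} =
      σ ⁻¹' {p | f (basis K Xᵒᵈ p) ≠ 0} := by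
    ext p
    simp only [Set.mem_ofPred_eq, Set.mem_preimage, basis_eq_e, LinearMap.comp_apply,
      LinearEquiv.coe_coe, dualEquiv_e]
    rfl
  rw [h]
  exact ⟨fun hf => by simpa only [Set.image_preimage_eq _ σ.surjective] using hf.image σ,
    fun hf => hf.preimage σ.injective.injOn⟩

variable [LocallyFiniteOrder X]

open scoped Classical in
/-- The element of the incidence algebra with value `1` on the pairs `(x, y)` with `y ∈ s`, and
`0` on all others. -/
noncomputable def rowIndicator (K : Type u) [Field K] {X : Type v} [PartialOrder X]
    (x : X) (s : Set X) : DualAlgebra K (IncidenceCoalgebra K X) :=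
  WithConv.toConv ((basis K X).constr K fun p => if p.1.1 = x ∧ p.1.2 ∈ s then 1 else 0)

omit [LocallyFiniteOrder X] in
open scoped Classical in
lemma rowIndicator_e (x : X) (s : Set X) {a b : X} (h : a ≤ b) :
    (rowIndicator K x s) (e K a b) =
      if a = x ∧ b ∈ s then 1 else 0 := by
  rw [← basis_mk K h]
  exact (basis K X).constr_basis K _ _

omit [LocallyFiniteOrder X] in
lemma rowIndicator_eq_zero {x : X} {s : Set X} {c : IncidenceCoalgebra K X}
    (h : ∀ p ∈ ((basis K X).repr c).support, p.1.1 ≠ x) : (rowIndicator K x s) c = 0 := by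
  classical
  rw [← (basis K X).linearCombination_repr c, Finsupp.linearCombination_apply, Finsupp.sum,
    map_sum]
  refine Finset.sum_eq_zero fun p hp => ?_
  rw [map_smul, basis_eq_e, rowIndicator_e _ _ p.2, if_neg fun h1 => h p hp h1.1, smul_zero]

lemma rowIndicator_mul_apply_e (x : X) (f : DualAlgebra K (IncidenceCoalgebra K X)) {b : X}
    (h : x ≤ b) : (rowIndicator K x {x} * f) (e K x b) = f (e K x b) := by
  classical
  rw [mul_apply_e, Finset.sum_eq_single x]
  · rw [rowIndicator_e x _ le_rfl, if_pos ⟨rfl, rfl⟩, one_mul]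
  · intro z hz hzx
    rw [rowIndicator_e x _ (Finset.mem_Icc.1 hz).1, if_neg fun h => hzx h.2, zero_mul]
  · exact fun hx => absurd (Finset.mem_Icc.2 ⟨le_rfl, h⟩) hx

open scoped Classical in
lemma mul_rowIndicator_apply_e (x : X) (s : Set X) (g : DualAlgebra K (IncidenceCoalgebra K X))
    (a b : X) : (g * rowIndicator K x s) (e K a b) =
      if a ≤ x ∧ x ≤ b ∧ b ∈ s then g (e K a x) else 0 := by
  have h1 : ∀ z ∈ Finset.Icc a b, g (e K a z) * (rowIndicator K x s) (e K z b) =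
        if z = x then (if b ∈ s then g (e K a x) else 0) else 0 := by
    intro z hz
    rw [rowIndicator_e x s (Finset.mem_Icc.1 hz).2]
    by_cases hzx : z = x
    · subst hzx; simp
    · simp [hzx]
  rw [mul_apply_e, Finset.sum_congr rfl h1, Finset.sum_ite_eq']
  by_cases h2 : a ≤ x <;> by_cases h3 : x ≤ b <;> simp [h2, h3]

/-- With `χ_{x,s}` for `rowIndicator K x s`, one has `g * χ_{x,s} = ∑_{c ≤ x} g(e_{c,x}) χ_{c, s ∩
[x, ∞)}`. The sum is finite by `hx`, whatever the size of `s`. -/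
lemma rowIndicator_mem_leftRationalPart {x : X} (hx : (Set.Iic x).Finite) (s : Set X) :
    rowIndicator K x s ∈ leftRationalPart K (IncidenceCoalgebra K X) := by
  classical
  have : Fintype (Set.Iic x) := hx.fintype
  let ψ := (Fintype.equivFin (Set.Iic x)).symm
  refine ⟨_, fun i => e K (ψ i).1 x, fun i => rowIndicator K (ψ i).1 (s ∩ Set.Ici x),
    fun g => dual_ext fun a b hab => ?_⟩
  rw [mul_rowIndicator_apply_e x s g, WithConv.ofConv_sum, LinearMap.sum_apply]
  simp only [WithConv.ofConv_smul, LinearMap.smul_apply]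
  rw [ψ.sum_comp (fun c : Set.Iic x => g (e K c.1 x) • (rowIndicator K c.1 (s ∩ Set.Ici x)) (e K a b))]
  simp only [rowIndicator_e _ _ hab, smul_eq_mul, mul_ite, mul_one, mul_zero]
  by_cases hax : a ≤ x
  · rw [Finset.sum_eq_single (⟨a, hax⟩ : Set.Iic x)]
    · simp [hax, and_comm]
    · intro c _ hc
      exact if_neg fun h' => hc (Subtype.ext h'.1.symm)
    · simp
  · rw [if_neg fun h => hax h.1, Finset.sum_eq_zero]
    intro c _
    exact if_neg fun h' : a = c.1 ∧ _ => hax (h'.1.symm ▸ c.2)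

/-- If `a ≤ x` is not the first index of a basis element occurring in some `cᵢ`, then `E_{a,x}`
kills every `cᵢ`. Rationality then gives `E_{a,x} * E_{x,x} = 0`, although this product is
`E_{a,x}`. -/
lemma finite_Iic_of_rowIndicator_mem {x : X}
    (h : rowIndicator K x {x} ∈ leftRationalPart K (IncidenceCoalgebra K X)) :
    (Set.Iic x).Finite := by
  classical
  obtain ⟨n, c, h, hf⟩ := h
  refine ((Finset.univ.biUnion fun i => ((basis K X).repr (c i)).support).image
    fun p => p.1.1).finite_toSet.subset fun a ha => ?_
  by_contra hmem
  have hzero : ∀ i, (rowIndicator K a {x}) (c i) = 0 := by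
    refine fun i => rowIndicator_eq_zero fun p hp h1 => hmem ?_
    simp only [Finset.coe_image, Set.mem_image, Finset.mem_coe, Finset.mem_biUnion]
    exact ⟨p, ⟨i, Finset.mem_univ _, hp⟩, h1⟩
  have h1 := hf (rowIndicator K a {x})
  simp only [hzero, zero_smul, Finset.sum_const_zero] at h1
  have h2 := mul_rowIndicator_apply_e x {x} (rowIndicator K a {x}) a x
  rw [h1, rowIndicator_e _ _ (Set.mem_Iic.1 ha)] at h2
  simp [Set.mem_Iic.1 ha] at h2

lemma FIA_eq_leftRationalPart_iff :
    FIA K X = leftRationalPart K (IncidenceCoalgebra K X) ↔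
      ∀ x : X, {a : X | a ≤ x}.Finite ∧ {b : X | x ≤ b}.Finite := by
  classical
  have finite_row : ∀ (x : X) (s : Set X), rowIndicator K x s ∈ FIA K X ↔
      {b | x ≤ b ∧ b ∈ s}.Finite := by
    intro x s
    rw [mem_FIA_iff]
    have : {b | x ≤ b ∧ b ∈ s} = (fun p : {p : X × X // p.1 ≤ p.2} => p.1.2) ''
        {p | (rowIndicator K x s) (basis K X p) ≠ 0} := by
      ext b
      simp only [Set.mem_image, Set.mem_ofPred_eq]
      constructor
      · rintro ⟨hb, hs⟩
        refine ⟨⟨(x, b), hb⟩, ?_, rfl⟩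
        rw [basis_mk, rowIndicator_e _ _ hb, if_pos ⟨rfl, hs⟩]
        exact one_ne_zero
      · rintro ⟨p, hp, rfl⟩
        rw [basis_eq_e, rowIndicator_e _ _ p.2] at hp
        have := of_not_not fun h => hp (if_neg h)
        exact ⟨this.1 ▸ p.2, this.2⟩
    rw [this, Set.finite_image_iff]
    rintro ⟨⟨p, p'⟩, hp⟩ h1 ⟨⟨q, q'⟩, hq⟩ h2 h3
    simp only [Set.mem_ofPred_eq, basis_eq_e, rowIndicator_e _ _ hp, rowIndicator_e _ _ hq, ne_eq,
      ite_eq_right_iff, one_ne_zero, imp_false, not_not] at h1 h2 h3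
    simp [h1.1, h2.1, h3]
  constructor
  · intro h x
    have hx : (Set.Iic x).Finite := by
      refine finite_Iic_of_rowIndicator_mem (K := K) (h ▸ (finite_row x {x}).2 ?_)
      exact (Set.finite_singleton x).subset fun b hb => hb.2
    refine ⟨hx, ?_⟩
    -- The full row of ones at `x` is left rational because `Iic x` is finite; its support is a copy
    -- of `Ici x`.
    have := (finite_row x Set.univ).1 (h ▸ rowIndicator_mem_leftRationalPart hx Set.univ)
    simpa using this
  · intro h
    apply le_antisymm
    · refine Submodule.span_le.2 ?_
      rintro _ ⟨p, rfl⟩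
      have : incidenceDualElement K X p = rowIndicator K p.1.1 {p.1.2} := by
        refine dual_ext fun a b hab => ?_
        rw [rowIndicator_e _ _ hab]
        refine (coord_e K p hab).trans (if_congr ?_ rfl rfl)
        rw [Set.mem_singleton_iff, eq_comm, @eq_comm _ b]
      rw [this]
      exact rowIndicator_mem_leftRationalPart (h _).1 _
    · rintro f ⟨n, c, k, hf⟩
      rw [mem_FIA_iff]
      -- `T` consists of the rows that occur in the `cᵢ`. For `x ∉ T`, row `x` of `f` is `E_{x,x} *
      -- f = ∑ E_{x,x}(cᵢ) kᵢ = 0`; the rows in `T` are finite as the up-sets are.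
      let T : Finset X := (Finset.univ.biUnion fun i => ((basis K X).repr (c i)).support).image
        fun p => p.1.1
      have hT : (⋃ x ∈ T, (fun b => (x, b)) '' {b : X | x ≤ b}).Finite :=
        T.finite_toSet.biUnion fun x _ => (h x).2.image _
      refine (hT.preimage Subtype.val_injective.injOn).subset ?_
      rintro ⟨⟨x, b⟩, hxb⟩ hp
      replace hxb : x ≤ b := hxb
      simp only [Set.mem_preimage, Set.mem_iUnion, Set.mem_image, Set.mem_ofPred_eq]
      refine ⟨x, ?_, b, hxb, rfl⟩
      by_contra hx
      refine hp ?_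
      rw [basis_mk, ← rowIndicator_mul_apply_e x f hxb, hf]
      have hzero : ∀ i, (rowIndicator K x {x}) (c i) = 0 := by
        refine fun i => rowIndicator_eq_zero fun p hp h1 => hx ?_
        simp only [T, Finset.mem_image, Finset.mem_biUnion]
        exact ⟨p, ⟨i, Finset.mem_univ _, hp⟩, h1⟩
      simp [hzero]

lemma FIA_eq_rightRationalPart_iff :
    FIA K X = rightRationalPart K (IncidenceCoalgebra K X) ↔
      ∀ x : X, {a : X | a ≤ x}.Finite ∧ {b : X | x ≤ b}.Finite := by
  have h : FIA K X = rightRationalPart K (IncidenceCoalgebra K X) ↔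
      FIA K Xᵒᵈ = leftRationalPart K (IncidenceCoalgebra K Xᵒᵈ) := by
    rw [SetLike.ext_iff, SetLike.ext_iff]
    -- Starting from `Xᵒᵈ`, the target is the incidence coalgebra of `Xᵒᵈᵒᵈ`, which is `X` by
    -- definition.
    have hφ := isCoalgebraAntiIso_dualEquiv K Xᵒᵈ
    constructor
    · intro h f
      have hf : f = WithConv.toConv ((f.ofConv ∘ₗ (dualEquiv K Xᵒᵈ).symm.toLinearMap) ∘ₗ
          (dualEquiv K Xᵒᵈ).toLinearMap) := by
        ext c
        simp
      rw [hf]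
      exact (mem_FIA_dual_iff (X := Xᵒᵈ) (WithConv.toConv _)).trans ((h _).trans
        (mem_leftRationalPart_iff_of_antiIso _ hφ (WithConv.toConv _)).symm)
    · intro h f
      exact (mem_FIA_dual_iff (X := Xᵒᵈ) f).symm.trans ((h _).trans
        (mem_leftRationalPart_iff_of_antiIso _ hφ f))
  rw [h, FIA_eq_leftRationalPart_iff]
  exact forall_congr' fun _ => and_comm

end RationalPart

/-! ### Comodules along a coalgebra anti-isomorphism -/

section AntiIso

variable {K : Type u} [Field K] {C D : Type v} [AddCommGroup C] [Module K C] [Coalgebra K C]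
  [AddCommGroup D] [Module K D] [Coalgebra K D] {φ : C ≃ₗ[K] D}

lemma IsCoalgebraAntiIso.symm (h : IsCoalgebraAntiIso φ) : IsCoalgebraAntiIso φ.symm where
  comul := by
    ext d
    obtain ⟨c, rfl⟩ := φ.surjective d
    have h1 := LinearMap.congr_fun h.comul c
    simp only [LinearMap.comp_apply, LinearEquiv.coe_coe, LinearEquiv.symm_apply_apply] at h1 ⊢
    rw [h1]
    generalize (Coalgebra.comul c : C ⊗[K] C) = t
    induction t with
    | zero => simp
    | add s t hs ht =>
      simp only [map_add]
      rw [← hs, ← ht]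
    | tmul s t => simp
  counit := by
    ext d
    obtain ⟨c, rfl⟩ := φ.surjective d
    simpa using (LinearMap.congr_fun h.counit c).symm

/-- The right comodule obtained from a left comodule along a coalgebra anti-isomorphism. -/
@[simps carrier coact]
noncomputable def LeftComodule.toRight (h : IsCoalgebraAntiIso φ) (M : LeftComodule.{u, v, w} K C) :
    RightComodule.{u, v, w} K D where
  carrier := M.carrier
  coact := (TensorProduct.comm K D M.carrier).toLinearMap ∘ₗ φ.toLinearMap.rTensor M.carrier ∘ₗ
    M.coact
  coassoc := by
    -- `G` sends `c ⊗ (c' ⊗ m)` to `m ⊗ (φ c' ⊗ φ c)`. By `h2` and `h3`, both sides of the new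
    -- coassociativity law are images under `G` of the sides of the old one.
    let G : C ⊗[K] (C ⊗[K] M.carrier) →ₗ[K] M.carrier ⊗[K] (D ⊗[K] D) :=
      (TensorProduct.comm K _ _).toLinearMap ∘ₗ
        (TensorProduct.comm K D D).toLinearMap.rTensor M.carrier ∘ₗ
        (TensorProduct.map φ.toLinearMap φ.toLinearMap).rTensor M.carrier ∘ₗ
        (TensorProduct.assoc K C C M.carrier).symm.toLinearMap
    ext m
    have h1 := congr(G $(LinearMap.congr_fun M.coassoc m))
    simp only [LinearMap.comp_apply, LinearEquiv.coe_coe] at h1 ⊢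
    have h2 : ∀ t : C ⊗[K] M.carrier, (TensorProduct.assoc K M.carrier D D)
        (((TensorProduct.comm K D M.carrier).toLinearMap ∘ₗ φ.toLinearMap.rTensor M.carrier ∘ₗ
          M.coact).rTensor D ((TensorProduct.comm K D M.carrier)
            (φ.toLinearMap.rTensor M.carrier t))) = G (M.coact.lTensor C t) := by
      intro t
      induction t with
      | zero => simp
      | add s t hs ht => simp only [map_add, hs, ht]
      | tmul c m =>
        simp only [LinearMap.rTensor_tmul, LinearMap.lTensor_tmul, LinearEquiv.coe_coe,
          TensorProduct.comm_tmul, LinearMap.comp_apply]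
        generalize M.coact m = t
        induction t with
        | zero => simp
        | add s t hs ht => simp only [map_add, TensorProduct.add_tmul, TensorProduct.tmul_add, hs, ht]
        | tmul c' m => simp [G]
    have h3 : ∀ t : C ⊗[K] M.carrier, (Coalgebra.comul (R := K) (A := D)).lTensor M.carrier
        ((TensorProduct.comm K D M.carrier) (φ.toLinearMap.rTensor M.carrier t)) =
          G ((TensorProduct.assoc K C C M.carrier)
            ((Coalgebra.comul (R := K) (A := C)).rTensor M.carrier t)) := by
      intro t
      induction t with
      | zero => simp
      | add s t hs ht => simp only [map_add, hs, ht]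
      | tmul c m =>
        have h4 := LinearMap.congr_fun h.comul c
        simp only [LinearMap.comp_apply, LinearEquiv.coe_coe] at h4
        simp [G, h4]
    rw [h2, h3, h1]
  counit_coact := by
    ext m
    have h1 := congr((TensorProduct.comm K _ _) $(LinearMap.congr_fun M.counit_coact m))
    simp only [LinearMap.comp_apply, LinearEquiv.coe_coe, TensorProduct.mk_apply,
      TensorProduct.comm_tmul, LinearMap.flip_apply] at h1 ⊢
    rw [← h1]
    generalize M.coact m = t
    induction t with
    | zero => simp
    | add s t hs ht => simp only [map_add, hs, ht]
    | tmul c m =>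
      have h4 := LinearMap.congr_fun h.counit c
      simp only [LinearMap.comp_apply, LinearEquiv.coe_coe] at h4
      simp [h4]

/-- The left comodule obtained from a right comodule along a coalgebra anti-isomorphism. -/
@[simps carrier coact]
noncomputable def RightComodule.toLeft (h : IsCoalgebraAntiIso φ) (M : RightComodule.{u, v, w} K C) :
    LeftComodule.{u, v, w} K D where
  carrier := M.carrier
  coact := (TensorProduct.comm K M.carrier D).toLinearMap ∘ₗ φ.toLinearMap.lTensor M.carrier ∘ₗ
    M.coact
  coassoc := by
    -- Again the order of the three factors is reversed: `m ⊗ (c ⊗ c')` goes to `φ c' ⊗ (φ c ⊗ m)`.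
    let G : M.carrier ⊗[K] (C ⊗[K] C) →ₗ[K] D ⊗[K] (D ⊗[K] M.carrier) :=
      (TensorProduct.assoc K D D M.carrier).toLinearMap ∘ₗ
      (TensorProduct.comm K _ _).toLinearMap ∘ₗ
        (TensorProduct.comm K D D).toLinearMap.lTensor M.carrier ∘ₗ
        (TensorProduct.map φ.toLinearMap φ.toLinearMap).lTensor M.carrier
    ext m
    have h1 := congr(G $(LinearMap.congr_fun M.coassoc m))
    simp only [LinearMap.comp_apply, LinearEquiv.coe_coe] at h1 ⊢
    have h2 : ∀ t : M.carrier ⊗[K] C,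
        ((TensorProduct.comm K M.carrier D).toLinearMap ∘ₗ φ.toLinearMap.lTensor M.carrier ∘ₗ
          M.coact).lTensor D ((TensorProduct.comm K M.carrier D)
            (φ.toLinearMap.lTensor M.carrier t)) =
          G (TensorProduct.assoc K M.carrier C C (M.coact.rTensor C t)) := by
      intro t
      induction t with
      | zero => simp
      | add s t hs ht => simp only [map_add, hs, ht]
      | tmul m c =>
        simp only [LinearMap.rTensor_tmul, LinearMap.lTensor_tmul, LinearEquiv.coe_coe,
          TensorProduct.comm_tmul, LinearMap.comp_apply]
        generalize M.coact m = t
        induction t with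
        | zero => simp
        | add s t hs ht => simp only [map_add, TensorProduct.add_tmul, TensorProduct.tmul_add, hs, ht]
        | tmul m c' => simp [G]
    have h3 : ∀ t : M.carrier ⊗[K] C, (TensorProduct.assoc K D D M.carrier)
        ((Coalgebra.comul (R := K) (A := D)).rTensor M.carrier
        ((TensorProduct.comm K M.carrier D) (φ.toLinearMap.lTensor M.carrier t))) =
          G ((Coalgebra.comul (R := K) (A := C)).lTensor M.carrier t) := by
      intro t
      induction t with
      | zero => simp
      | add s t hs ht => simp only [map_add, hs, ht]
      | tmul m c =>
        have h4 := LinearMap.congr_fun h.comul c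
        simp only [LinearMap.comp_apply, LinearEquiv.coe_coe] at h4
        simp [G, h4]
    rw [h2, h3, h1]
  counit_coact := by
    ext m
    have h1 := congr((TensorProduct.comm K _ _) $(LinearMap.congr_fun M.counit_coact m))
    simp only [LinearMap.comp_apply, LinearEquiv.coe_coe, TensorProduct.mk_apply,
      TensorProduct.comm_tmul, LinearMap.flip_apply] at h1 ⊢
    rw [← h1]
    generalize M.coact m = t
    induction t with
    | zero => simp
    | add s t hs ht => simp only [map_add, hs, ht]
    | tmul m c =>
      have h4 := LinearMap.congr_fun h.counit c
      simp only [LinearMap.comp_apply, LinearEquiv.coe_coe] at h4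
      simp [h4]

/-- Left comodules over `C` are right comodules over `D`, if there is a coalgebra
anti-isomorphism from `C` to `D`. -/
noncomputable def LeftComodule.toRightFunctor (h : IsCoalgebraAntiIso φ) :
    LeftComodule.{u, v, w} K C ⥤ RightComodule.{u, v, w} K D where
  obj M := M.toRight h
  map {M N} f := ⟨f.toLinearMap, by
    refine LinearMap.ext fun (m : M.carrier) => ?_
    have h1 : N.coact (f.toLinearMap m) = f.toLinearMap.lTensor C (M.coact m) :=
      LinearMap.congr_fun f.comm m
    change (TensorProduct.comm K D N.carrier) (φ.toLinearMap.rTensor N.carrier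
      (N.coact (f.toLinearMap m))) = f.toLinearMap.rTensor D ((TensorProduct.comm K D M.carrier)
        (φ.toLinearMap.rTensor M.carrier (M.coact m)))
    rw [h1]
    generalize M.coact m = t
    induction t with
    | zero => simp
    | add s t hs ht => simp only [map_add, hs, ht]
    | tmul c m => simp⟩

/-- Right comodules over `C` are left comodules over `D`, if there is a coalgebra
anti-isomorphism from `C` to `D`. -/
noncomputable def RightComodule.toLeftFunctor (h : IsCoalgebraAntiIso φ) :
    RightComodule.{u, v, w} K C ⥤ LeftComodule.{u, v, w} K D where
  obj M := M.toLeft h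
  map {M N} f := ⟨f.toLinearMap, by
    refine LinearMap.ext fun (m : M.carrier) => ?_
    have h1 : N.coact (f.toLinearMap m) = f.toLinearMap.rTensor C (M.coact m) :=
      LinearMap.congr_fun f.comm m
    change (TensorProduct.comm K N.carrier D) (φ.toLinearMap.lTensor N.carrier
      (N.coact (f.toLinearMap m))) = f.toLinearMap.lTensor D ((TensorProduct.comm K M.carrier D)
        (φ.toLinearMap.lTensor M.carrier (M.coact m)))
    rw [h1]
    generalize M.coact m = t
    induction t with
    | zero => simp
    | add s t hs ht => simp only [map_add, hs, ht]
    | tmul m c => simp⟩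

lemma LeftComodule.toLeft_toRight_coact (h : IsCoalgebraAntiIso φ)
    (M : LeftComodule.{u, v, w} K C) : ((M.toRight h).toLeft h.symm).coact = M.coact := by
  refine LinearMap.ext fun m => ?_
  change (TensorProduct.comm K M.carrier C) (φ.symm.toLinearMap.lTensor M.carrier
    ((TensorProduct.comm K D M.carrier) (φ.toLinearMap.rTensor M.carrier (M.coact m)))) = M.coact m
  generalize M.coact m = t
  induction t with
  | zero => simp
  | add s t hs ht => simp only [map_add, hs, ht]
  | tmul c m => simp

lemma RightComodule.toRight_toLeft_coact (h : IsCoalgebraAntiIso φ)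
    (M : RightComodule.{u, v, w} K D) : ((M.toLeft h.symm).toRight h).coact = M.coact := by
  refine LinearMap.ext fun m => ?_
  change (TensorProduct.comm K D M.carrier) (φ.toLinearMap.rTensor M.carrier
    ((TensorProduct.comm K M.carrier C) (φ.symm.toLinearMap.lTensor M.carrier (M.coact m)))) =
      M.coact m
  generalize M.coact m = t
  induction t with
  | zero => simp
  | add s t hs ht => simp only [map_add, hs, ht]
  | tmul c m => simp

/-- A coalgebra anti-isomorphism from `C` to `D` identifies the left comodules over `C` with the
right comodules over `D`. -/
noncomputable def IsCoalgebraAntiIso.comoduleEquivalence (h : IsCoalgebraAntiIso φ) :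
    LeftComodule.{u, v, w} K C ≌ RightComodule.{u, v, w} K D :=
  CategoryTheory.Equivalence.mk (LeftComodule.toRightFunctor h)
    (RightComodule.toLeftFunctor h.symm)
    (NatIso.ofComponents (fun M =>
      { hom := ⟨LinearMap.id, by
          refine Eq.trans ?_ (congrArg (· ∘ₗ _) (LinearMap.lTensor_id _ _).symm)
          exact M.toLeft_toRight_coact h⟩
        inv := ⟨LinearMap.id, by
          refine Eq.trans ?_ (congrArg (· ∘ₗ _) (LinearMap.lTensor_id _ _).symm)
          exact (M.toLeft_toRight_coact h).symm⟩
        hom_inv_id := rfl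
        inv_hom_id := rfl }) (fun _ => rfl))
    (NatIso.ofComponents (fun M =>
      { hom := ⟨LinearMap.id, by
          refine Eq.trans ?_ (congrArg (· ∘ₗ _) (LinearMap.rTensor_id _ _).symm)
          exact (M.toRight_toLeft_coact h).symm⟩
        inv := ⟨LinearMap.id, by
          refine Eq.trans ?_ (congrArg (· ∘ₗ _) (LinearMap.rTensor_id _ _).symm)
          exact M.toRight_toLeft_coact h⟩
        hom_inv_id := rfl
        inv_hom_id := rfl }) (fun _ => rfl))

lemma IsCoalgebraAntiIso.isLeftSemiperfect_iff (h : IsCoalgebraAntiIso φ) :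
    IsLeftSemiperfect K C ↔ IsRightSemiperfect K D :=
  h.comoduleEquivalence.enoughProjectives_iff

end AntiIso

/-! ### Epimorphisms of right comodules -/

namespace RightComodule

section General

variable {K : Type u} [Field K] {C : Type v} [AddCommGroup C] [Module K C] [Coalgebra K C]

lemma hom_coact {M N : RightComodule.{u, v, w} K C} (f : M ⟶ N) (m : M.carrier) :
    N.coact (f.toLinearMap m) = f.toLinearMap.rTensor C (M.coact m) :=
  LinearMap.congr_fun f.comm m

/-- The quotient of a right comodule by the image of a morphism. -/
noncomputable def coker {M N : RightComodule.{u, v, w} K C} (f : M ⟶ N) :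
    RightComodule.{u, v, w} K C where
  carrier := N.carrier ⧸ LinearMap.range f.toLinearMap
  coact := (LinearMap.range f.toLinearMap).liftQ
    ((LinearMap.range f.toLinearMap).mkQ.rTensor C ∘ₗ N.coact) (by
      rintro _ ⟨m, rfl⟩
      rw [LinearMap.mem_ker, LinearMap.comp_apply, hom_coact f m, ← LinearMap.comp_apply,
        ← LinearMap.rTensor_comp, LinearMap.range_mkQ_comp, LinearMap.rTensor_zero,
        LinearMap.zero_apply])
  coassoc := by
    set R := LinearMap.range f.toLinearMap
    set q := R.mkQ
    refine Submodule.linearMap_qext _ (LinearMap.ext fun n => ?_)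
    simp only [LinearMap.comp_apply, Submodule.mkQ_apply, Submodule.liftQ_apply,
      LinearEquiv.coe_coe]
    have h1 := LinearMap.congr_fun N.coassoc n
    simp only [LinearMap.comp_apply, LinearEquiv.coe_coe] at h1
    rw [← LinearMap.comp_apply (LinearMap.lTensor _ _), LinearMap.lTensor_comp_rTensor,
      ← LinearMap.rTensor_comp_lTensor, LinearMap.comp_apply, ← h1,
      ← LinearMap.comp_apply (LinearMap.rTensor _ _) (LinearMap.rTensor _ _),
      ← LinearMap.rTensor_comp, Submodule.liftQ_mkQ]
    generalize N.coact n = t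
    induction t with
    | zero => simp
    | add s t hs ht => simp only [map_add, hs, ht]
    | tmul n c =>
      simp only [LinearMap.rTensor_tmul, LinearMap.comp_apply]
      generalize N.coact n = t
      induction t with
      | zero => simp
      | add s t hs ht => simp only [map_add, TensorProduct.add_tmul, hs, ht]
      | tmul n c' => simp
  counit_coact := by
    refine Submodule.linearMap_qext _ (LinearMap.ext fun n => ?_)
    have h1 := LinearMap.congr_fun N.counit_coact n
    simp only [LinearMap.comp_apply] at h1
    simp only [LinearMap.comp_apply, Submodule.mkQ_apply, Submodule.liftQ_apply]
    rw [← LinearMap.comp_apply (LinearMap.lTensor _ _), LinearMap.lTensor_comp_rTensor,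
      ← LinearMap.rTensor_comp_lTensor, LinearMap.comp_apply, h1]
    simp

/-- The projection onto the quotient of a right comodule by the image of a morphism. -/
noncomputable def cokerπ {M N : RightComodule.{u, v, w} K C} (f : M ⟶ N) : N ⟶ coker f :=
  ⟨(LinearMap.range f.toLinearMap).mkQ, Submodule.liftQ_mkQ _ _ _⟩

/-- The projection onto the cokernel and the zero map agree after `f`, so they are equal and the
cokernel vanishes. -/
lemma surjective_of_epi {M N : RightComodule.{u, v, w} K C} (f : M ⟶ N) [Epi f] :
    Function.Surjective f.toLinearMap := by
  let z : N ⟶ coker f := ⟨0, by simp⟩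
  have h1 : f ≫ cokerπ f = f ≫ z := by
    refine Hom.ext ?_
    change (LinearMap.range f.toLinearMap).mkQ ∘ₗ f.toLinearMap =
      (0 : N.carrier →ₗ[K] N.carrier ⧸ LinearMap.range f.toLinearMap) ∘ₗ f.toLinearMap
    rw [LinearMap.range_mkQ_comp, LinearMap.zero_comp]
  have h2 : (LinearMap.range f.toLinearMap).mkQ = 0 :=
    congrArg Hom.toLinearMap ((cancel_epi f).1 h1)
  rw [← LinearMap.range_eq_top, ← Submodule.ker_mkQ (LinearMap.range f.toLinearMap), h2,
    LinearMap.ker_zero]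

lemma epi_of_surjective {M N : RightComodule.{u, v, w} K C} (f : M ⟶ N)
    (hf : Function.Surjective f.toLinearMap) : Epi f where
  left_cancellation g h hgh := by
    have h1 : g.toLinearMap ∘ₗ f.toLinearMap = h.toLinearMap ∘ₗ f.toLinearMap :=
      congrArg Hom.toLinearMap hgh
    exact Hom.ext (LinearMap.cancel_right hf |>.1 h1)

end General

/-! ### Right comodules over the incidence coalgebra -/

section Incidence

open IncidenceCoalgebra

variable {K : Type u} [Field K] {X : Type v} [PartialOrder X]

lemma tensor_ext {M : Type*} [AddCommGroup M] [Module K M] {s t : M ⊗[K] IncidenceCoalgebra K X}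
    (h : ∀ p, ((basis K X).coord p).lTensor M s = ((basis K X).coord p).lTensor M t) : s = t := by
  classical
  refine (TensorProduct.equivFinsuppOfBasisRight (basis K X)).injective (Finsupp.ext fun p => ?_)
  rw [TensorProduct.equivFinsuppOfBasisRight_apply, TensorProduct.equivFinsuppOfBasisRight_apply, h]

variable [LocallyFiniteOrder X]

/-- The action of the element `E_{x,y}` of the incidence algebra on a right comodule. -/
noncomputable def act (M : RightComodule.{u, max u v, w} K (IncidenceCoalgebra K X))
    (p : {p : X × X // p.1 ≤ p.2}) : M.carrier →ₗ[K] M.carrier :=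
  (TensorProduct.rid K M.carrier).toLinearMap ∘ₗ ((basis K X).coord p).lTensor M.carrier ∘ₗ M.coact

variable (M N : RightComodule.{u, max u v, w} K (IncidenceCoalgebra K X))

open scoped Classical in
lemma act_apply (p : {p : X × X // p.1 ≤ p.2}) (m : M.carrier) :
    M.act p m = TensorProduct.equivFinsuppOfBasisRight (basis K X) (M.coact m) p :=
  (TensorProduct.equivFinsuppOfBasisRight_apply _ _ _).symm

lemma finite_act_ne_zero (m : M.carrier) : {p | M.act p m ≠ 0}.Finite := by
  classical
  refine (TensorProduct.equivFinsuppOfBasisRight (basis K X) (M.coact m)).support.finite_toSet.subset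
    fun p hp => ?_
  rw [Finset.mem_coe, Finsupp.mem_support_iff, ← act_apply]
  exact hp

/-- The counit law writes `m` as a finite linear combination of the vectors `M.act p m`. -/
lemma mem_of_act_mem (m : M.carrier) (S : Submodule K M.carrier) (h : ∀ p, M.act p m ∈ S) :
    m ∈ S := by
  classical
  have h1 := LinearMap.congr_fun M.counit_coact m
  rw [LinearMap.comp_apply, ← (TensorProduct.equivFinsuppOfBasisRight (basis K X)).symm_apply_apply
    (M.coact m), TensorProduct.equivFinsuppOfBasisRight_symm_apply, Finsupp.sum, map_sum] at h1
  have h2 := congr(TensorProduct.rid K M.carrier $h1)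
  simp only [map_sum, LinearMap.lTensor_tmul, TensorProduct.rid_tmul, LinearMap.flip_apply,
    TensorProduct.mk_apply, one_smul] at h2
  rw [← h2]
  refine Submodule.sum_mem _ fun p _ => Submodule.smul_mem _ _ ?_
  rw [← act_apply]
  exact h p

variable {M N} in
lemma hom_act (f : M ⟶ N) (p : {p : X × X // p.1 ≤ p.2}) (m : M.carrier) :
    N.act p (f.toLinearMap m) = f.toLinearMap (M.act p m) := by
  simp only [act, LinearMap.comp_apply, hom_coact, LinearEquiv.coe_coe]
  generalize M.coact m = t
  induction t with
  | zero => simp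
  | add s t hs ht => simp only [map_add, hs, ht]
  | tmul m c => simp

-- The matrix unit rule `E_{x,y} E_{u,v} = δ_{y,u} E_{x,v}`. It holds for forms on the coalgebra
-- (`h2`), and coassociativity carries it over to the action (`h5`).
open scoped Classical in
lemma act_act (p q : {p : X × X // p.1 ≤ p.2}) (m : M.carrier) :
    M.act p (M.act q m) =
      if h : p.1.2 = q.1.1 then M.act ⟨(p.1.1, q.1.2), p.2.trans (h.le.trans q.2)⟩ m else 0 := by
  let ev (φ : IncidenceCoalgebra K X ⊗[K] IncidenceCoalgebra K X →ₗ[K] K) :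
    M.carrier ⊗[K] (IncidenceCoalgebra K X ⊗[K] IncidenceCoalgebra K X) →ₗ[K] M.carrier :=
    (TensorProduct.rid K M.carrier).toLinearMap ∘ₗ φ.lTensor M.carrier
  let φ := LinearMap.mul' K K ∘ₗ TensorProduct.map ((basis K X).coord p) ((basis K X).coord q)
  have h1 := congr(ev φ $(LinearMap.congr_fun M.coassoc m))
  have h2 : φ ∘ₗ Coalgebra.comul =
      if h : p.1.2 = q.1.1 then (basis K X).coord ⟨(p.1.1, q.1.2), p.2.trans (h.le.trans q.2)⟩
      else 0 := by
    refine linearMap_ext fun x y hxy => ?_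
    have h3 : ∀ z ∈ Finset.Icc x y, φ (e K x z ⊗ₜ e K z y) =
        if z = p.1.2 then (if p.1.1 = x ∧ p.1.2 = q.1.1 ∧ q.1.2 = y then 1 else 0) else 0 := by
      intro z hz
      rw [Finset.mem_Icc] at hz
      simp only [φ, LinearMap.comp_apply, TensorProduct.map_tmul, LinearMap.mul'_apply,
        coord_e K _ hz.1, coord_e K _ hz.2]
      by_cases hzp : z = p.1.2
      · rw [hzp, if_pos rfl, @eq_comm _ q.1.1]
        by_cases h4 : p.1.1 = x <;> by_cases h5 : p.1.2 = q.1.1 <;> simp [h4, h5]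
      · simp [hzp, Ne.symm hzp]
    rw [LinearMap.comp_apply, comul_e', map_sum, Finset.sum_congr rfl h3, Finset.sum_ite_eq']
    by_cases h4 : p.1.2 = q.1.1
    · rw [dif_pos h4, coord_e K _ hxy]
      by_cases h5 : p.1.1 = x ∧ q.1.2 = y
      · rw [if_pos, if_pos ⟨h5.1, h4, h5.2⟩, if_pos h5]
        rw [Finset.mem_Icc, ← h5.1, ← h5.2]
        exact ⟨p.2, h4.le.trans q.2⟩
      · simp [h4, h5]
    · simp [h4]
  have h5 : ∀ t : M.carrier ⊗[K] IncidenceCoalgebra K X,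
      ev φ (TensorProduct.assoc K _ _ _ (M.coact.rTensor _ t)) =
        M.act p ((TensorProduct.rid K M.carrier) (((basis K X).coord q).lTensor M.carrier t)) := by
    intro t
    induction t with
    | zero => simp
    | add s t hs ht => simp only [map_add, hs, ht]
    | tmul m c =>
      simp only [LinearMap.rTensor_tmul, LinearMap.lTensor_tmul, TensorProduct.rid_tmul, map_smul]
      simp only [act, LinearMap.comp_apply, LinearEquiv.coe_coe]
      generalize M.coact m = t
      induction t with
      | zero => simp
      | add s t hs ht => simp only [map_add, TensorProduct.add_tmul, smul_add, hs, ht]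
      | tmul m c' => simp [ev, φ, smul_smul, mul_comm]
  simp only [LinearMap.comp_apply, LinearEquiv.coe_coe] at h1
  rw [h5] at h1
  refine h1.trans ?_
  simp only [ev, LinearMap.comp_apply]
  rw [← LinearMap.comp_apply (LinearMap.lTensor _ _), ← LinearMap.lTensor_comp, h2]
  split_ifs
  · rfl
  · simp

/-- The coaction of `ofConvex`. -/
noncomputable def ofConvexCoact {I : Type max u v} (S : I → Finset X) :
    ((Σ i, S i) →₀ K) →ₗ[K] ((Σ i, S i) →₀ K) ⊗[K] IncidenceCoalgebra K X :=
  Finsupp.linearCombination K fun j =>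
    ∑ z : S j.1, Finsupp.single (⟨j.1, z⟩ : Σ i, S i) (1 : K) ⊗ₜ[K] e K z.1 j.2.1

omit [LocallyFiniteOrder X] in
lemma ofConvexCoact_single {I : Type max u v} (S : I → Finset X) (i : I) (a : S i) :
    ofConvexCoact S (Finsupp.single ⟨i, a⟩ 1) =
      ∑ z : S i, Finsupp.single (⟨i, z⟩ : Σ i, S i) (1 : K) ⊗ₜ[K] e K z.1 a.1 :=
  (Finsupp.linearCombination_single K _ _).trans (one_smul _ _)

/-- The right comodule with basis the pairs `(i, a)` with `a` in the convex finite set `S i`, on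
which `E_{x,y}` takes `(i, y)` to `(i, x)`. -/
noncomputable def ofConvex {I : Type max u v} (S : I → Finset X) (hS : ∀ i, (S i : Set X).OrdConnected) :
    RightComodule.{u, max u v, max u v} K (IncidenceCoalgebra K X) where
  carrier := (Σ i, S i) →₀ K
  coact := ofConvexCoact S
  coassoc := by
    classical
    refine Finsupp.lhom_ext' fun ⟨i, a⟩ => LinearMap.ext_ring ?_
    simp only [LinearMap.comp_apply, Finsupp.lsingle_apply, ofConvexCoact_single,
      map_sum, LinearMap.rTensor_tmul, LinearMap.lTensor_tmul, LinearEquiv.coe_coe,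
      TensorProduct.sum_tmul, TensorProduct.assoc_tmul, comul_e', TensorProduct.tmul_sum]
    refine Finset.sum_comm.trans (Finset.sum_congr rfl fun t _ => ?_)
    -- Compare the sum over `z ∈ S i` with the sum over `[t, a]`. Convexity puts the interval inside
    -- `S i`, and outside it `e t z` or `e z a` is `0` by the convention on `e`.
    refine (Finset.sum_coe_sort (M := ((Σ i, S i) →₀ K) ⊗[K]
      (IncidenceCoalgebra K X ⊗[K] IncidenceCoalgebra K X)) (S i) fun z =>
      Finsupp.single (⟨i, t⟩ : Σ i, S i) (1 : K) ⊗ₜ[K]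
      (e K t.1 z ⊗ₜ[K] e K z a.1)).trans (Finset.sum_subset (fun z hz => ?_) fun z _ hz => ?_).symm
    · exact (hS i).out t.2 a.2 (Finset.mem_Icc.1 hz)
    · rw [Finset.mem_Icc, not_and_or] at hz
      rcases hz with hz | hz <;> simp [e_eq_zero K hz]
  counit_coact := by
    classical
    refine Finsupp.lhom_ext' fun ⟨i, a⟩ => LinearMap.ext_ring ?_
    simp only [LinearMap.comp_apply, Finsupp.lsingle_apply, ofConvexCoact_single,
      map_sum, LinearMap.lTensor_tmul, LinearMap.flip_apply, TensorProduct.mk_apply]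
    rw [Finset.sum_eq_single a]
    · rw [counit_e K le_rfl, if_pos rfl]
    · intro z _ hz
      by_cases hza : z.1 ≤ a.1
      · rw [counit_e K hza, if_neg fun h => hz (Subtype.ext h), TensorProduct.tmul_zero]
      · rw [e_eq_zero K hza, map_zero, TensorProduct.tmul_zero]
    · simp

-- The operators `act p` are the coordinates of the coaction, so they determine it. Colinearity can
-- thus be checked on basis vectors through `act`.
variable {M N} in
lemma comm_of_act (f : M.carrier →ₗ[K] N.carrier) (h : ∀ p m, N.act p (f m) = f (M.act p m)) :
    N.coact ∘ₗ f = f.rTensor _ ∘ₗ M.coact := by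
  refine LinearMap.ext fun m => tensor_ext fun p => ?_
  refine (TensorProduct.rid K N.carrier).injective ((h p m).trans ?_)
  simp only [act, LinearMap.comp_apply, LinearEquiv.coe_coe]
  generalize M.coact m = t
  induction t with
  | zero => simp
  | add s t hs ht => simp only [map_add, hs, ht]
  | tmul m c => simp

section OfConvex

variable {I : Type max u v} {S : I → Finset X} {hS : ∀ i, (S i : Set X).OrdConnected}

/-- The basis elements of `ofConvex S hS`. -/
noncomputable def ofConvexBasis (S : I → Finset X) (hS : ∀ i, (S i : Set X).OrdConnected)
    (i : I) (a : S i) : (ofConvex (K := K) S hS).carrier :=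
  Finsupp.single (⟨i, a⟩ : Σ i, S i) (1 : K)

lemma ofConvex_ext {V : Type*} [AddCommGroup V] [Module K V]
    {f g : (ofConvex (K := K) S hS).carrier →ₗ[K] V}
    (h : ∀ i a, f (ofConvexBasis S hS i a) = g (ofConvexBasis S hS i a)) : f = g :=
  Finsupp.lhom_ext' fun ⟨i, a⟩ => LinearMap.ext_ring (h i a)

lemma mem_of_ofConvexBasis_mem (T : Submodule K (ofConvex (K := K) S hS).carrier)
    (h : ∀ i a, ofConvexBasis S hS i a ∈ T) (m : (ofConvex (K := K) S hS).carrier) : m ∈ T := by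
  have h1 : T.mkQ = 0 := ofConvex_ext fun i a => by simpa using h i a
  rw [← Submodule.ker_mkQ T, h1]
  exact LinearMap.zero_apply m

/-- The coordinate forms of the basis `ofConvexBasis`. -/
noncomputable def ofConvexCoord (S : I → Finset X) (hS : ∀ i, (S i : Set X).OrdConnected)
    (i : I) (a : S i) : (ofConvex (K := K) S hS).carrier →ₗ[K] K :=
  Finsupp.lapply (⟨i, a⟩ : Σ i, S i)

open scoped Classical in
lemma ofConvexCoord_basis (i : I) (a c : S i) :
    ofConvexCoord (K := K) S hS i a (ofConvexBasis S hS i c) = if c = a then 1 else 0 := by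
  refine (Finsupp.single_apply).trans (if_congr ?_ rfl rfl)
  simp

open scoped Classical in
lemma act_ofConvexBasis (p : {p : X × X // p.1 ≤ p.2}) (i : I) (a : S i) :
    (ofConvex (K := K) S hS).act p (ofConvexBasis S hS i a) =
      if h : p.1.2 = a.1 ∧ p.1.1 ∈ S i then ofConvexBasis S hS i ⟨p.1.1, h.2⟩ else 0 := by
  have h1 : (ofConvex (K := K) S hS).coact (ofConvexBasis S hS i a) =
      ∑ z : S i, ofConvexBasis S hS i z ⊗ₜ[K] e K z.1 a.1 :=
    ofConvexCoact_single S i a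
  rw [act, LinearMap.comp_apply, LinearMap.comp_apply, h1, map_sum, map_sum]
  have h2 : ∀ z : S i, (basis K X).coord p (e K z.1 a.1) =
      if p.1.1 = z.1 ∧ p.1.2 = a.1 then 1 else 0 := by
    intro z
    by_cases hz : z.1 ≤ a.1
    · exact coord_e K p hz
    · rw [e_eq_zero K hz, map_zero, if_neg]
      rintro ⟨h3, h4⟩
      exact hz (h3 ▸ h4 ▸ p.2)
  simp only [LinearMap.lTensor_tmul, LinearEquiv.coe_coe, TensorProduct.rid_tmul, h2]
  split_ifs with h
  · rw [Finset.sum_eq_single ⟨p.1.1, h.2⟩]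
    · rw [if_pos ⟨rfl, h.1⟩, one_smul]
    · intro z _ hz
      rw [if_neg fun h' : p.1.1 = z.1 ∧ p.1.2 = a.1 => hz (Subtype.ext h'.1.symm), zero_smul]
    · simp
  · refine Finset.sum_eq_zero fun z _ => ?_
    rw [if_neg fun h' : p.1.1 = z.1 ∧ p.1.2 = a.1 => h ⟨h'.2, h'.1 ▸ z.2⟩, zero_smul]

end OfConvex

/-! ### Projective comodules on finite principal down-sets -/

section Free

variable (hX : ∀ x : X, (Set.Iic x).Finite) {I : Type max u v} (b : I → X)

/-- The projective right comodule on generators of degrees `b i`. -/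
noncomputable def free : RightComodule.{u, max u v, max u v} K (IncidenceCoalgebra K X) :=
  ofConvex (fun i => (hX (b i)).toFinset) fun i => by
    rw [Set.Finite.coe_toFinset]
    exact Set.ordConnected_Iic

/-- The basis elements of `free hX b`. -/
noncomputable def freeBasis (i : I) (a : X) (h : a ≤ b i) : (free (K := K) hX b).carrier :=
  ofConvexBasis _ _ i ⟨a, (hX (b i)).mem_toFinset.2 h⟩

lemma act_freeBasis (p : {p : X × X // p.1 ≤ p.2}) (i : I) (h : p.1.2 ≤ b i) :
    (free (K := K) hX b).act p (freeBasis hX b i p.1.2 h) =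
      freeBasis hX b i p.1.1 (p.2.trans h) := by
  classical
  refine (act_ofConvexBasis p i _).trans (dif_pos ⟨rfl, ?_⟩)
  exact (hX (b i)).mem_toFinset.2 (p.2.trans h)

lemma act_freeBasis_of_ne (p : {p : X × X // p.1 ≤ p.2}) (i : I) (a : X) (h : a ≤ b i)
    (ha : p.1.2 ≠ a) : (free (K := K) hX b).act p (freeBasis hX b i a h) = 0 := by
  classical
  exact (act_ofConvexBasis p i _).trans (dif_neg fun h => ha h.1)

variable {hX b} in
lemma free_ext {V : Type*} [AddCommGroup V] [Module K V] {f g : (free (K := K) hX b).carrier →ₗ[K] V}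
    (h : ∀ i a ha, f (freeBasis hX b i a ha) = g (freeBasis hX b i a ha)) : f = g :=
  ofConvex_ext fun i a => h i a.1 ((hX (b i)).mem_toFinset.1 a.2)

variable {N : RightComodule.{u, max u v, max u v} K (IncidenceCoalgebra K X)}

/-- The linear map underlying `freeHom`. -/
noncomputable def freeLinearMap (n : I → N.carrier) : (free (K := K) hX b).carrier →ₗ[K] N.carrier :=
  Finsupp.linearCombination K fun j : Σ i, (hX (b i)).toFinset =>
    N.act ⟨(j.2.1, b j.1), (hX (b j.1)).mem_toFinset.1 j.2.2⟩ (n j.1)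

/-- For `a = b i` the value is `E_{b i, b i} n i`, the component of `n i` in degree `b i`. Hence `n
i` may be any vector of `N`. -/
lemma freeLinearMap_freeBasis (n : I → N.carrier) (i : I) (a : X) (h : a ≤ b i) :
    freeLinearMap hX b n (freeBasis hX b i a h) = N.act ⟨(a, b i), h⟩ (n i) :=
  (Finsupp.linearCombination_single K _ _).trans (one_smul _ _)

/-- The morphism from `free hX b` that is given by the images of the generators. -/
noncomputable def freeHom (n : I → N.carrier) : free (K := K) hX b ⟶ N :=
  ⟨freeLinearMap hX b n, comm_of_act _ fun p => LinearMap.congr_fun (free_ext (f := N.act p ∘ₗ _)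
    (g := freeLinearMap hX b n ∘ₗ RightComodule.act _ p) fun i a ha => by
      rw [LinearMap.comp_apply, LinearMap.comp_apply, freeLinearMap_freeBasis, act_act]
      split_ifs with h
      · replace h : p.1.2 = a := h
        subst h
        rw [act_freeBasis, freeLinearMap_freeBasis]
      · rw [act_freeBasis_of_ne hX b p i a ha h, map_zero])⟩

/-- A lift is obtained by choosing preimages of the images of the generators. They need not be
homogeneous, since `freeHom` projects them to the right degree. -/
lemma projective_free : Projective (free (K := K) hX b) where
  factors {E Y} f g _ := by
    have hg := surjective_of_epi g
    choose n hn using fun i => hg (f.toLinearMap (freeBasis hX b i (b i) le_rfl))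
    refine ⟨freeHom hX b n, Hom.ext ?_⟩
    refine free_ext (f := g.toLinearMap ∘ₗ freeLinearMap hX b n) fun i a ha => ?_
    rw [LinearMap.comp_apply, freeLinearMap_freeBasis, ← hom_act, hn, hom_act,
      act_freeBasis hX b ⟨(a, b i), ha⟩]

end Free

lemma isRightSemiperfect_of_finite_Iic (hX : ∀ x : X, (Set.Iic x).Finite) :
    IsRightSemiperfect K (IncidenceCoalgebra K X) where
  presentation M := by
    -- One generator for each vector `m` and degree `x`. The image then contains every `E_{a,x} m`,
    -- hence every `m`.
    let f : free (K := K) hX (Prod.snd : M.carrier × X → X) ⟶ M := freeHom hX _ Prod.fst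
    have hf : Epi f := epi_of_surjective f fun m => by
      rw [← LinearMap.mem_range]
      refine mem_of_act_mem M m _ fun p => ⟨freeBasis hX _ (m, p.1.2) p.1.1 p.2, ?_⟩
      exact freeLinearMap_freeBasis hX _ Prod.fst _ _ _
    exact ⟨{ p := _, projective := projective_free hX _, f := f, epi := hf }⟩

/-- `S₁` gives the simple comodule at `b`, and `m` is a lift of its generator to a projective `P`.
Only finitely many operators are nonzero on `m`, so it is enough that `E_{a,b} m ≠ 0` for all `a ≤
b`; the interval comodule `S₂` tests this. -/
lemma finite_Iic_of_isRightSemiperfect (h : IsRightSemiperfect K (IncidenceCoalgebra K X)) (b : X) :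
    (Set.Iic b).Finite := by
  classical
  let S₁ : PUnit.{max u v + 1} → Finset X := fun _ => {b}
  have hS₁ : ∀ i, (S₁ i : Set X).OrdConnected := fun _ => by
    simpa [S₁] using Set.ordConnected_singleton
  obtain ⟨⟨P, π⟩⟩ := h.presentation (ofConvex (K := K) S₁ hS₁)
  have hb : b ∈ S₁ ⟨⟩ := Finset.mem_singleton_self b
  obtain ⟨m, hm⟩ := surjective_of_epi π (ofConvexBasis S₁ hS₁ ⟨⟩ ⟨b, hb⟩)
  refine ((P.finite_act_ne_zero m).image fun p => p.1.1).subset fun a hab => ?_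
  replace hab : a ≤ b := hab
  refine ⟨⟨(a, b), hab⟩, fun hzero => ?_, rfl⟩
  let S₂ : PUnit.{max u v + 1} → Finset X := fun _ => Finset.Icc a b
  have hS₂ : ∀ i, (S₂ i : Set X).OrdConnected := fun _ => by
    simpa [S₂] using Set.ordConnected_Icc
  have ha₂ : a ∈ S₂ ⟨⟩ := Finset.mem_Icc.2 ⟨le_rfl, hab⟩
  have hb₂ : b ∈ S₂ ⟨⟩ := Finset.mem_Icc.2 ⟨hab, le_rfl⟩
  -- `q` keeps the top vector `b` of the interval and kills the others. They span a subcomodule,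
  -- because the operators only lower indices.
  let q : (ofConvex (K := K) S₂ hS₂).carrier →ₗ[K] (ofConvex (K := K) S₁ hS₁).carrier :=
    Finsupp.linearCombination K fun j : Σ i, S₂ i =>
      if j.2.1 = b then ofConvexBasis S₁ hS₁ ⟨⟩ ⟨b, hb⟩ else 0
  have hq : ∀ i c, q (ofConvexBasis S₂ hS₂ i c) =
      if c.1 = b then ofConvexBasis S₁ hS₁ ⟨⟩ ⟨b, hb⟩ else 0 := fun i c =>
    (Finsupp.linearCombination_single K _ _).trans (one_smul _ _)
  let Q : ofConvex (K := K) S₂ hS₂ ⟶ ofConvex (K := K) S₁ hS₁ :=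
    ⟨q, comm_of_act q fun p => LinearMap.congr_fun (ofConvex_ext
      (f := RightComodule.act _ p ∘ₗ q) (g := q ∘ₗ RightComodule.act _ p) fun i c => by
        have hc := Finset.mem_Icc.1 c.2
        rw [LinearMap.comp_apply, LinearMap.comp_apply, hq, act_ofConvexBasis]
        by_cases h1 : c.1 = b
        · have h2 : p.1.2 = c.1 ↔ p.1.2 = b := by rw [h1]
          rw [if_pos h1, act_ofConvexBasis]
          by_cases h3 : p.1.1 = b
          · by_cases h4 : p.1.2 = b
            · rw [dif_pos ⟨h4, Finset.mem_singleton.2 h3⟩,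
                dif_pos ⟨h2.2 h4, Finset.mem_Icc.2 ⟨h3 ▸ hab, h3.le⟩⟩, hq, if_pos h3]
              exact congrArg _ (Subtype.ext h3)
            · rw [dif_neg fun h => h4 h.1, dif_neg fun h => h4 (h2.1 h.1), map_zero]
          · rw [dif_neg fun h => h3 (Finset.mem_singleton.1 h.2)]
            split_ifs with h5
            · rw [hq, if_neg h3]
            · rw [map_zero]
        · rw [if_neg h1, map_zero]
          split_ifs with h2
          · rw [hq, if_neg]
            intro h3
            exact h1 (le_antisymm hc.2 (h3.symm.le.trans (p.2.trans h2.1.le)))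
          · rw [map_zero])⟩
  have hQ : Epi Q := epi_of_surjective Q <| mem_of_ofConvexBasis_mem (LinearMap.range q) fun i c =>
    ⟨ofConvexBasis S₂ hS₂ ⟨⟩ ⟨b, hb₂⟩, by
      rw [hq, if_pos rfl]
      exact congrArg _ (Subtype.ext (Finset.mem_singleton.1 c.2).symm)⟩
  obtain ⟨l, hl⟩ := Projective.factors π Q
  -- `E_{a,b}` moves the `b`-coordinate to the `a`-coordinate, and by `h2` the map `q` reads off the
  -- same `b`-coordinate. For `l m` it equals `1`, whereas `hzero` gives `E_{a,b} (l m) = l (E_{a,b}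
  -- m) = 0`.
  have h1 : ofConvexCoord S₂ hS₂ ⟨⟩ ⟨a, ha₂⟩ ∘ₗ RightComodule.act _ ⟨(a, b), hab⟩ =
      ofConvexCoord (K := K) S₂ hS₂ ⟨⟩ ⟨b, hb₂⟩ := ofConvex_ext fun _ c => by
    rw [LinearMap.comp_apply, act_ofConvexBasis, ofConvexCoord_basis]
    by_cases hc : c.1 = b
    · rw [dif_pos ⟨hc.symm, ha₂⟩, ofConvexCoord_basis, if_pos rfl, if_pos (Subtype.ext hc)]
    · rw [dif_neg fun h => hc h.1.symm, map_zero, if_neg fun h => hc (congrArg Subtype.val h)]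
  have h2 : ofConvexCoord S₁ hS₁ ⟨⟩ ⟨b, hb⟩ ∘ₗ q =
      ofConvexCoord (K := K) S₂ hS₂ ⟨⟩ ⟨b, hb₂⟩ := ofConvex_ext fun _ c => by
    rw [LinearMap.comp_apply, hq, ofConvexCoord_basis]
    by_cases hc : c.1 = b
    · rw [if_pos hc, ofConvexCoord_basis, if_pos rfl, if_pos (Subtype.ext hc)]
    · rw [if_neg hc, map_zero, if_neg fun h => hc (congrArg Subtype.val h)]
  have h3 : q (l.toLinearMap m) = ofConvexBasis S₁ hS₁ ⟨⟩ ⟨b, hb⟩ := by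
    rw [← hm, ← hl]
    rfl
  have h4 := LinearMap.congr_fun (h1.trans h2.symm) (l.toLinearMap m)
  rw [LinearMap.comp_apply, LinearMap.comp_apply, h3, hom_act, hzero, map_zero, map_zero,
    ofConvexCoord_basis, if_pos rfl] at h4
  exact zero_ne_one h4

lemma isRightSemiperfect_iff :
    IsRightSemiperfect K (IncidenceCoalgebra K X) ↔ ∀ x : X, (Set.Iic x).Finite :=
  ⟨finite_Iic_of_isRightSemiperfect, isRightSemiperfect_of_finite_Iic⟩

end Incidence

end RightComodule

/-! ### Left semiperfectness by order reversal, and the equivalences -/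

section Main

open IncidenceCoalgebra

variable (K : Type u) [Field K] (X : Type v) [PartialOrder X] [LocallyFiniteOrder X]

lemma isLeftSemiperfect_incidenceCoalgebra_iff :
    IsLeftSemiperfect K (IncidenceCoalgebra K X) ↔ ∀ x : X, (Set.Ici x).Finite := by
  rw [(isCoalgebraAntiIso_dualEquiv K X).isLeftSemiperfect_iff]
  exact RightComodule.isRightSemiperfect_iff

end Main

theorem theorem4p3 (K : Type u) [Field K] (X : Type v) [PartialOrder X] [LocallyFiniteOrder X] :
    List.TFAE
      [FIA K X = leftRationalPart K (IncidenceCoalgebra K X),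
       FIA K X = rightRationalPart K (IncidenceCoalgebra K X),
       ∀ x : X, {a : X | a ≤ x}.Finite ∧ {b : X | x ≤ b}.Finite,
       IsLeftSemiperfect K (IncidenceCoalgebra K X) ∧
         IsRightSemiperfect K (IncidenceCoalgebra K X)] := by
  tfae_have 1 ↔ 3 := FIA_eq_leftRationalPart_iff
  tfae_have 2 ↔ 3 := by
    rw [FIA_eq_rightRationalPart_iff]
  tfae_have 3 ↔ 4 := by
    rw [isLeftSemiperfect_incidenceCoalgebra_iff, RightComodule.isRightSemiperfect_iff, and_comm,
      ← forall_and]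
    rfl
  tfae_finish
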